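/- Let $N\ge 1$, $d_1,\dots,d_N\ge 0$, and let $(\Omega,\mathcal A,P)$ be a probability space. For $1\le j\le N$ let $h^{(j)}:\mathbb{R}^{d_1}\times\cdots\times\mathbb{R}^{d_N}\to\mathbb{R}^{d_j}$ be Lipschitz continuous, let $x^{(j)}_0$ and $M^{(j)}_{n}$, $n\ge 1$, be $\mathbb{R}^{d_j}$-valued random variables, and let $$x^{(j)}_{n+1}=x^{(j)}_n+\alpha^{(j)}_n\bigl(h^{(j)}(x^{(1)}_n,\dots,x^{(N)}_n)+M^{(j)}_{n+1}\bigr),\qquad n\ge 0,\ 1\le j\le N.$$ Put $\mathcal F_n=\sigma\bigl(x^{(j)}_i,\ 0\le i\le n;\ M^{(j)}_i,\ 1\le i\le n;\ 1\le j\le N\bigr)$. Assume: (Noise) for all $j$ and $n\ge 0$, $M^{(j)}_{n+1}$ is integrable and $\mathbb E[M^{(j)}_{n+1}\mid\mathcal F_n]=0$ a.s., and there are constants $K^{(j)}>0$ with $\mathbb E[\|M^{(j)}_{n+1}\|^2\mid\mathcal F_n]\le K^{(j)}\bigl(1+\sum_{k=1}^N\|x^{(k)}_n\|^2\bigr)$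 a.s. for all $n\ge0$. (Step sizes) the $\alpha^{(j)}_n>0$ are real numbers with $\sum_n\alpha^{(j)}_n=\infty$ for every $j$, $\sum_n\sum_{j}(\alpha^{(j)}_n)^2<\infty$, and $\alpha^{(j)}_n/\alpha^{(j-1)}_n\to 0$ as $n\to\infty$ for $1<j\le N$. (Stability) $\sup_n\sum_{j=1}^N\|x^{(j)}_n\|<\infty$ a.s. (Equilibria) There are Lipschitz continuous maps $\lambda^{(i)}:\mathbb{R}^{d_{i+1}}\times\cdots\times\mathbb{R}^{d_N}\to\mathbb{R}^{d_i}$, $1\le i\le N-1$, and a point $x^{(N)}_*\in\mathbb{R}^{d_N}$ as follows. For $1\le i\le N$ and $(x^{(i)},\dots,x^{(N)})$ define $z^{(j)}=x^{(j)}$ for $j\ge i$ and, recursively for $j=i-1,i-2,\dots,1$, $z^{(j)}=\lambda^{(j)}(z^{(j+1)},\dots,z^{(N)})$; write $H^{(i)}(x^{(i)},\dots,x^{(N)})=h^{(i)}(z^{(1)},\dots,z^{(N)})$. For each $i\le N-1$ and all fixed $x^{(i+1)},\dots,x^{(N)}$, the ODE $\dot u(t)=H^{(i)}(u(t),x^{(i+1)},\dots,x^{(N)})$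 has $\lambda^{(i)}(x^{(i+1)},\dots,x^{(N)})$ as globally asymptotically stable equilibrium, and the ODE $\dot u(t)=H^{(N)}(u(t))$ has $x^{(N)}_*$ as globally asymptotically stable equilibrium. For $v\in\mathbb{R}^{d_N}$ let $\lambda^{(N:N-1)}(v)=v$ and, recursively for $j=N-1,\dots,1$, $\lambda^{(j:N-1)}(v)=\lambda^{(j)}\bigl(\lambda^{(j+1:N-1)}(v),\dots,\lambda^{(N-1:N-1)}(v),v\bigr)$. Then, almost surely, as $n\to\infty$, $x^{(j)}_n\to\lambda^{(j:N-1)}(x^{(N)}_*)$ for every $1\le j\le N-1$, and $x^{(N)}_n\to x^{(N)}_*$. -/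

import Mathlib

open MeasureTheory Filter Topology
open scoped ENNReal

/-- The parameter space of the `j`-th timescale: the Euclidean space of dimension `d j`. -/
abbrev Block {N : ℕ} (d : Fin N → ℕ) (j : Fin N) : Type := EuclideanSpace ℝ (Fin (d j))

/-- The joint parameter space: tuples with one entry per timescale, ordered from the fastest
timescale (smallest index) to the slowest (index `⊤`). -/
abbrev State {N : ℕ} (d : Fin N → ℕ) : Type := ∀ j : Fin N, Block d j

/-- Tuples of parameters of the timescales strictly slower than `i`. -/
abbrev SlowerState {N : ℕ} (d : Fin N → ℕ) (i : Fin N) : Type :=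
  ∀ k : {k : Fin N // i < k}, Block d k.1

/-- `e` is a globally asymptotically stable equilibrium of the autonomous equation `y' = f y`:
it is an equilibrium, it is Lyapunov stable, and every forward solution converges to it. -/
structure IsGlobAsympStable {E : Type*} [NormedAddCommGroup E] [NormedSpace ℝ E]
    (f : E → E) (e : E) : Prop where
  equilibrium : f e = 0
  stable : ∀ ε > 0, ∃ δ > 0, ∀ y : ℝ → E, IsIntegralCurveOn y (fun _ => f) (Set.Ici 0) →
    ‖y 0 - e‖ < δ → ∀ t ≥ 0, ‖y t - e‖ < ε
  attractive : ∀ y : ℝ → E, IsIntegralCurveOn y (fun _ => f) (Set.Ici 0) →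
    Tendsto y atTop (𝓝 e)

/-- Nested substitution of the equilibrium maps below level `i`: the entries with index `j ≥ i` are
those of `x`, and, downwards from `j = i - 1`, every entry with index `j < i` is the value of the
`j`-th equilibrium map at the entries with index larger than `j`. The entries of `x` with index
smaller than `i` are not used. -/
noncomputable def nest {N : ℕ} {d : Fin N → ℕ} (lam : ∀ i : Fin N, SlowerState d i → Block d i)
    (i : Fin N) (x : State d) (j : Fin N) : Block d j :=
  if j < i then lam j (fun k => nest lam i x k.1) else x j
termination_by N - j.val
decreasing_by
  have _hlt : j.val < k.1.val := k.2
  have _hN : k.1.val < N := k.1.isLt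
  omega

theorem nest_of_lt {N : ℕ} {d : Fin N → ℕ} (lam : ∀ i : Fin N, SlowerState d i → Block d i)
    {i j : Fin N} (x : State d) (h : j < i) :
    nest lam i x j = lam j (fun k => nest lam i x k.1) := by
  rw [nest, if_pos h]

theorem nest_of_le {N : ℕ} {d : Fin N → ℕ} (lam : ∀ i : Fin N, SlowerState d i → Block d i)
    {i j : Fin N} (x : State d) (h : i ≤ j) :
    nest lam i x j = x j := by
  rw [nest, if_neg (not_lt.mpr h)]

/-- The right-hand side of the limiting equation of timescale `i`, as a function of `x^{(i)} = u`:
the slower parameters are frozen at their values in `x`, and the faster ones are replaced by the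
nested equilibrium maps. It does not depend on the entries of `x` with index at most `i`. -/
noncomputable def limitField {N : ℕ} {d : Fin N → ℕ} (h : ∀ j : Fin N, State d → Block d j)
    (lam : ∀ i : Fin N, SlowerState d i → Block d i) (i : Fin N) (x : State d)
    (u : Block d i) : Block d i :=
  h i (nest lam i (Function.update x i u))

/-- `lamTo lam j v` is the value at `v` of the composed equilibrium map which expresses the `j`-th
parameter through the slowest one; at the slowest index `j = ⊤` it is `v` itself. -/
noncomputable def lamTo {N : ℕ} [NeZero N] {d : Fin N → ℕ}
    (lam : ∀ i : Fin N, SlowerState d i → Block d i) (j : Fin N) (v : Block d ⊤) : Block d j :=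
  nest lam ⊤ (Function.update 0 ⊤ v) j

/-- The sigma-field generated by the iterates up to time `n` and the noise variables with time
indices `1, …, n`. The arguments are `x j n ω` and `M j n ω`. -/
@[reducible] def history {N : ℕ} {d : Fin N → ℕ} {Ω : Type*} (x M : ∀ j : Fin N, ℕ → Ω → Block d j) (n : ℕ) :
    MeasurableSpace Ω :=
  ⨆ j : Fin N, (⨆ i : ℕ, ⨆ _ : i ≤ n, MeasurableSpace.comap (x j i) inferInstance) ⊔
    (⨆ i : ℕ, ⨆ _ : 1 ≤ i ∧ i ≤ n, MeasurableSpace.comap (M j i) inferInstance)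

/-! Measure time on timescale `i` by letting step `n` last `α i n`. The slower parameters then move
at relative speed `α k n / α i n → 0` and look constant, while the faster ones already sit near
their equilibrium maps. So `x i` is a perturbed Euler scheme for its limiting equation with slowly
drifting parameters. By induction from the fastest timescale to the slowest, `x i` minus its
equilibrium map at the slower entries tends to 0. At the slowest level that map is the constant
`xstar`, and substituting back gives all the limits.

Probability enters only through the noise: where the iterates stay bounded, the weighted noise sums
agree with an L²-bounded martingale and hence converge (`ae_exists_tendsto_sum_smul`). The rest is
pathwise (`tendsto_of_bounded_of_noise_converges`).

A single level is `tendsto_sub_equilibrium`. Attraction is uniform over compact sets of initial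
values and parameters (`IsParamFlow.exists_forall_ge_dist_lt`), so one time `T` serves all the
bounded iterates. Noise with convergent sums is small over late windows, so on windows of bounded
length the iterates shadow the flow (`exists_forall_dist_flow_lt`). Looking back by time `T` from a
late step shows that the iterate there is near equilibrium. -/

/-! ### Forward flows of Lipschitz fields: existence, uniqueness, Gronwall and Euler estimates. -/

section Flow

variable {E : Type*} [NormedAddCommGroup E] [NormedSpace ℝ E]

/-- Picard–Lindelöf on the ball of radius `‖F x‖`, where the field is at most `(1 + K) * ‖F x‖`:
scaling the radius with the speed makes the existence time independent of `x`. -/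
theorem exists_uniform_time_isIntegralCurveOn [CompleteSpace E] {F : E → E} {K : NNReal}
    (hF : LipschitzWith K F) :
    ∃ τ : ℝ, 0 < τ ∧ ∀ x : E, ∃ y : ℝ → E, y 0 = x ∧
      IsIntegralCurveOn y (fun _ => F) (Set.Icc 0 τ) := by
  refine ⟨1 / (2 * (K + 1)), by positivity, fun x => ?_⟩
  set τ : ℝ := 1 / (2 * ((K : ℝ) + 1)) with hτ
  have hτ0 : 0 < τ := by positivity
  have hKτ : (K + 1) * τ = 1 / 2 := by rw [hτ]; field_simp
  set a : NNReal := ‖F x‖₊ with ha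
  have hpl : IsPicardLindelof (fun _ => F) (⟨0, le_rfl, hτ0.le⟩ : Set.Icc (0 : ℝ) τ) x a 0
      (‖F x‖₊ + K * a) K := by
    refine IsPicardLindelof.of_time_independent (fun z hz => ?_) hF.lipschitzOnWith ?_
    · have h1 : ‖F z - F x‖ ≤ K * ‖z - x‖ := hF.norm_sub_le z x
      have h2 : ‖z - x‖ ≤ a := by simpa [dist_eq_norm] using hz
      have h3 : ‖F z‖ ≤ ‖F x‖ + ‖F z - F x‖ := by
        simpa using norm_add_le (F x) (F z - F x)
      push_cast
      have := mul_le_mul_of_nonneg_left h2 K.coe_nonneg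
      linarith
    · have h4 : max (τ - 0) ((0 : ℝ) - 0) = τ := by simp [hτ0.le]
      simp only [h4]
      push_cast
      have : (‖F x‖ + K * ‖F x‖) * τ = ‖F x‖ * (1 / 2) := by rw [← hKτ]; ring
      have := norm_nonneg (F x)
      simp only [ha, coe_nnnorm, sub_zero]
      linarith
  obtain ⟨y, h0, h1⟩ := hpl.exists_eq_forall_mem_Icc_hasDerivWithinAt₀
  exact ⟨y, h0, h1⟩

theorem IsIntegralCurveOn.shift {F : E → E} {y : ℝ → E} {s s' : Set ℝ} {c : ℝ}
    (hy : IsIntegralCurveOn y (fun _ => F) s) (hs : ∀ t ∈ s', t + c ∈ s) :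
    IsIntegralCurveOn (fun t => y (t + c)) (fun _ => F) s' := by
  intro t ht
  have h1 : HasDerivWithinAt (fun t : ℝ => t + c) 1 s' t :=
    ((hasDerivAt_id t).add_const c).hasDerivWithinAt
  simpa [Function.comp_def] using (hy (t + c) (hs t ht)).scomp t h1 hs

theorem hasDerivWithinAt_of_notMem {f : ℝ → E} {f' : E} {s : Set ℝ} {t : ℝ}
    (h : t ∉ closure s) : HasDerivWithinAt f f' s t :=
  HasFDerivWithinAt.of_notMem_closure h

theorem IsIntegralCurveOn.glue {F : E → E} {y z : ℝ → E} {a b : ℝ} (ha : 0 ≤ a) (hb : 0 ≤ b)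
    (hy : IsIntegralCurveOn y (fun _ => F) (Set.Icc 0 a))
    (hz : IsIntegralCurveOn z (fun _ => F) (Set.Icc 0 b)) (h : y a = z 0) :
    IsIntegralCurveOn (fun t => if t ≤ a then y t else z (t - a)) (fun _ => F)
      (Set.Icc 0 (a + b)) := by
  set w : ℝ → E := fun t => if t ≤ a then y t else z (t - a) with hw
  have hw1 : Set.EqOn w y (Set.Icc 0 a) := fun t ht => by simp [hw, ht.2]
  have hz' : IsIntegralCurveOn (fun t => z (t - a)) (fun _ => F) (Set.Icc a (a + b)) := by
    simpa [sub_eq_add_neg] using hz.shift (c := -a) (s' := Set.Icc a (a + b))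
      (fun t ht => ⟨by linarith [ht.1], by linarith [ht.2]⟩)
  have hw2 : Set.EqOn w (fun t => z (t - a)) (Set.Icc a (a + b)) := fun t ht => by
    rcases ht.1.eq_or_lt with rfl | h'
    · simp [hw, h]
    · simp [hw, not_le.2 h']
  have hd1 : ∀ t, t ≤ a → 0 ≤ t → HasDerivWithinAt w (F (w t)) (Set.Icc 0 a) t := fun t h1 h2 => by
    rw [hw1 ⟨h2, h1⟩]
    exact (hy t ⟨h2, h1⟩).congr_of_mem hw1 ⟨h2, h1⟩
  have hd2 : ∀ t, a ≤ t → t ≤ a + b → HasDerivWithinAt w (F (w t)) (Set.Icc a (a + b)) t :=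
    fun t h1 h2 => by
      rw [hw2 ⟨h1, h2⟩]
      exact (hz' t ⟨h1, h2⟩).congr_of_mem hw2 ⟨h1, h2⟩
  intro t ht
  change HasDerivWithinAt w (F (w t)) _ t
  rw [← Set.Icc_union_Icc_eq_Icc ha (by linarith : a ≤ a + b)]
  -- Away from `a` only one of the two intervals is adherent to `t`, so the derivative within the
  -- other is vacuous; at `a` the two one-sided derivatives agree.
  rcases lt_trichotomy t a with h1 | h1 | h1
  · refine (hd1 t h1.le ht.1).union (hasDerivWithinAt_of_notMem ?_)
    rw [isClosed_Icc.closure_eq]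
    exact fun h2 => absurd h2.1 (not_le.2 h1)
  · subst h1
    exact (hd1 t le_rfl ha).union (hd2 t le_rfl ht.2)
  · refine HasDerivWithinAt.union (hasDerivWithinAt_of_notMem ?_) (hd2 t h1.le ht.2)
    rw [isClosed_Icc.closure_eq]
    exact fun h2 => absurd h2.2 (not_le.2 h1)

theorem exists_isIntegralCurveOn_Icc [CompleteSpace E] {F : E → E} {K : NNReal}
    (hF : LipschitzWith K F) (x : E) (T : ℝ) :
    ∃ y : ℝ → E, y 0 = x ∧ IsIntegralCurveOn y (fun _ => F) (Set.Icc 0 T) := by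
  obtain ⟨τ, hτ, hloc⟩ := exists_uniform_time_isIntegralCurveOn hF
  have key : ∀ n : ℕ, ∃ y : ℝ → E, y 0 = x ∧
      IsIntegralCurveOn y (fun _ => F) (Set.Icc 0 (n * τ)) := by
    intro n
    induction n with
    | zero =>
      obtain ⟨y, h0, hy⟩ := hloc x
      exact ⟨y, h0, hy.mono (Set.Icc_subset_Icc_right (by simpa using hτ.le))⟩
    | succ n ih =>
      obtain ⟨y, h0, hy⟩ := ih
      obtain ⟨z, hz0, hz⟩ := hloc (y (n * τ))
      have hn : 0 ≤ (n : ℝ) * τ := by positivity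
      have := hy.glue hn hτ.le hz hz0.symm
      rw [show (n : ℝ) * τ + τ = ((n + 1 : ℕ) : ℝ) * τ by push_cast; ring] at this
      exact ⟨_, by simp [hn, h0], this⟩
  obtain ⟨n, hn⟩ := exists_nat_ge (T / τ)
  obtain ⟨y, h0, hy⟩ := key n
  exact ⟨y, h0, hy.mono (Set.Icc_subset_Icc_right ((div_le_iff₀ hτ).1 hn))⟩

theorem IsIntegralCurveOn.hasDerivWithinAt_Ici {F : E → E} {y : ℝ → E} {T t : ℝ}
    (hy : IsIntegralCurveOn y (fun _ => F) (Set.Icc 0 T)) (ht : t ∈ Set.Ico 0 T) :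
    HasDerivWithinAt y (F (y t)) (Set.Ici t) t :=
  ((hy t ⟨ht.1, ht.2.le⟩).mono (Set.Icc_subset_Icc_left ht.1)).mono_of_mem_nhdsWithin
    (Icc_mem_nhdsGE ht.2)

theorem IsIntegralCurveOn.eqOn_Icc {F : E → E} {K : NNReal} (hF : LipschitzWith K F)
    {y z : ℝ → E} {T : ℝ} (hy : IsIntegralCurveOn y (fun _ => F) (Set.Icc 0 T))
    (hz : IsIntegralCurveOn z (fun _ => F) (Set.Icc 0 T)) (h : y 0 = z 0) :
    Set.EqOn y z (Set.Icc 0 T) :=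
  ODE_solution_unique (v := fun _ => F) (fun _ => hF) hy.continuousOn
    (fun _ ht => hy.hasDerivWithinAt_Ici ht) hz.continuousOn
    (fun _ ht => hz.hasDerivWithinAt_Ici ht) h

/-- A Lipschitz vector field on a Banach space has forward solutions for all times. -/
theorem exists_isIntegralCurveOn_Ici [CompleteSpace E] {F : E → E} {K : NNReal}
    (hF : LipschitzWith K F) (x : E) :
    ∃ y : ℝ → E, y 0 = x ∧ IsIntegralCurveOn y (fun _ => F) (Set.Ici 0) := by
  choose y h0 hy using fun n : ℕ => exists_isIntegralCurveOn_Icc hF x n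
  have hcomp : ∀ m n : ℕ, m ≤ n → Set.EqOn (y m) (y n) (Set.Icc 0 m) := fun m n hmn =>
    (hy m).eqOn_Icc hF ((hy n).mono (Set.Icc_subset_Icc_right (by exact_mod_cast hmn)))
      ((h0 m).trans (h0 n).symm)
  set z : ℝ → E := fun t => y ⌈t⌉₊ t with hz
  have hzy : ∀ n : ℕ, Set.EqOn z (y n) (Set.Icc 0 n) := fun n t ht =>
    hcomp _ _ (Nat.ceil_le.2 ht.2) ⟨ht.1, Nat.le_ceil t⟩
  refine ⟨z, by simpa [hz] using h0 0, fun t ht => ?_⟩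
  obtain ⟨n, hn⟩ := exists_nat_gt t
  have htn : t ∈ Set.Icc (0 : ℝ) n := ⟨ht, hn.le⟩
  have h1 : HasDerivWithinAt z (F (z t)) (Set.Icc 0 n) t := by
    rw [hzy n htn]
    exact (hy n t htn).congr_of_mem (hzy n) htn
  refine h1.mono_of_mem_nhdsWithin ?_
  have : Set.Iic (n : ℝ) ∈ 𝓝 t := Iic_mem_nhds hn
  exact mem_nhdsWithin_iff_exists_mem_nhds_inter.2 ⟨_, this, fun s hs => ⟨hs.2, hs.1⟩⟩

theorem IsIntegralCurveOn.dist_le_mul_exp {F : E → E} {K : NNReal} (hF : LipschitzWith K F)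
    {y z : ℝ → E} (hy : IsIntegralCurveOn y (fun _ => F) (Set.Ici 0))
    (hz : IsIntegralCurveOn z (fun _ => F) (Set.Ici 0)) {t : ℝ} (ht : 0 ≤ t) :
    dist (y t) (z t) ≤ dist (y 0) (z 0) * Real.exp (K * t) := by
  have hsub : Set.Icc 0 t ⊆ Set.Ici (0 : ℝ) := fun s hs => hs.1
  simpa using dist_le_of_trajectories_ODE (v := fun _ => F) (fun _ => hF)
    (hy.mono hsub).continuousOn (fun _ hs => (hy.mono hsub).hasDerivWithinAt_Ici hs)
    (hz.mono hsub).continuousOn (fun _ hs => (hz.mono hsub).hasDerivWithinAt_Ici hs)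
    le_rfl t ⟨ht, le_rfl⟩

theorem IsIntegralCurveOn.eq_of_eq {F : E → E} {K : NNReal} (hF : LipschitzWith K F)
    {y z : ℝ → E} (hy : IsIntegralCurveOn y (fun _ => F) (Set.Ici 0))
    (hz : IsIntegralCurveOn z (fun _ => F) (Set.Ici 0)) (h : y 0 = z 0) {t : ℝ} (ht : 0 ≤ t) :
    y t = z t := by
  have := hy.dist_le_mul_exp hF hz ht
  rw [h, dist_self, zero_mul] at this
  exact dist_le_zero.1 this

/-- Gronwall against the constant curve at `y 0`, an approximate solution with defect `C`. -/
theorem IsIntegralCurveOn.dist_initial_le {F : E → E} {K : NNReal} (hF : LipschitzWith K F)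
    {y : ℝ → E} (hy : IsIntegralCurveOn y (fun _ => F) (Set.Ici 0)) {C t T : ℝ}
    (hC : ‖F (y 0)‖ ≤ C) (ht : 0 ≤ t) (htT : t ≤ T) :
    dist (y t) (y 0) ≤ gronwallBound 0 K C T := by
  have hC0 : 0 ≤ C := (norm_nonneg _).trans hC
  have hsub : Set.Icc 0 t ⊆ Set.Ici (0 : ℝ) := fun s hs => hs.1
  have h1 := dist_le_of_approx_trajectories_ODE (v := fun _ => F) (K := K) (a := 0) (b := t)
    (f := y) (f' := fun s => F (y s)) (g := fun _ => y 0) (g' := fun _ => 0) (εf := 0) (εg := C)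
    (δ := 0) (fun _ => hF) (hy.mono hsub).continuousOn
    (fun _ hs => (hy.mono hsub).hasDerivWithinAt_Ici hs) (fun _ _ => by simp)
    continuousOn_const (fun s _ => hasDerivWithinAt_const _ _ _)
    (fun _ _ => by simpa [dist_eq_norm] using hC) (by simp) t ⟨ht, le_rfl⟩
  rw [zero_add, sub_zero] at h1
  exact h1.trans (gronwallBound_mono le_rfl hC0 K.coe_nonneg htT)

/-- The curve moves by at most `C * a`, so `t ↦ y t - t • F (y s)` has derivative at most `K * C *
a`; the mean value inequality is used for both bounds. -/
theorem IsIntegralCurveOn.norm_euler_error_le {F : E → E} {K : NNReal} (hF : LipschitzWith K F)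
    {y : ℝ → E} (hy : IsIntegralCurveOn y (fun _ => F) (Set.Ici 0)) {C s a : ℝ} (hs : 0 ≤ s)
    (ha : 0 ≤ a) (hC : ∀ t ∈ Set.Icc s (s + a), ‖F (y t)‖ ≤ C) :
    ‖y (s + a) - y s - a • F (y s)‖ ≤ K * C * a * a := by
  have hC0 : 0 ≤ C := (norm_nonneg _).trans (hC s ⟨le_rfl, by linarith⟩)
  have hsub : Set.Icc s (s + a) ⊆ Set.Ici (0 : ℝ) := fun t ht => hs.trans ht.1
  have hd := hy.mono hsub
  have hmem : s ∈ Set.Icc s (s + a) := ⟨le_rfl, by linarith⟩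
  have hmem' : s + a ∈ Set.Icc s (s + a) := ⟨by linarith, le_rfl⟩
  have h1 : ∀ t ∈ Set.Icc s (s + a), ‖y t - y s‖ ≤ C * a := fun t ht => by
    refine ((convex_Icc s (s + a)).norm_image_sub_le_of_norm_hasDerivWithin_le
      (fun t ht => hd t ht) hC hmem ht).trans ?_
    rw [Real.norm_of_nonneg (by linarith [ht.1])]
    exact mul_le_mul_of_nonneg_left (by linarith [ht.2]) hC0
  have h2 := (convex_Icc s (s + a)).norm_image_sub_le_of_norm_hasDerivWithin_le
    (f := fun t => y t - t • F (y s)) (f' := fun t => F (y t) - F (y s)) (C := K * C * a)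
    (fun t ht => by
      simpa [Pi.sub_def] using
        (hd t ht).sub ((hasDerivAt_id t).smul_const (F (y s))).hasDerivWithinAt)
    (fun t ht => by
      refine (hF.norm_sub_le _ _).trans ?_
      rw [mul_assoc]
      exact mul_le_mul_of_nonneg_left (h1 t ht) K.coe_nonneg) hmem hmem'
  have h3 : y (s + a) - (s + a) • F (y s) - (y s - s • F (y s)) =
      y (s + a) - y s - a • F (y s) := by rw [add_smul]; abel
  simpa [h3, abs_of_nonneg ha] using h2

end Flow

/-! ### Uniform attraction for flows with a parameter. -/

section UniformAttraction

set_option linter.unusedSectionVars false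

variable {E W : Type*} [NormedAddCommGroup E] [NormedSpace ℝ E]
  [NormedAddCommGroup W] [NormedSpace ℝ W]

/-- `φ u w` is the forward solution of `y' = g y w` started at `u`, for every parameter `w`. -/
structure IsParamFlow (g : E → W → E) (φ : E → W → ℝ → E) : Prop where
  init : ∀ u w, φ u w 0 = u
  curve : ∀ u w, IsIntegralCurveOn (φ u w) (fun _ v => g v w) (Set.Ici 0)

/-- The vector field of the system `y' = g y w`, `w' = 0`. -/
def frozenField (g : E → W → E) (z : E × W) : E × W := (g z.1 z.2, 0)

theorem lipschitzWith_frozenField {g : E → W → E} {K : NNReal}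
    (hg : LipschitzWith K fun z : E × W => g z.1 z.2) : LipschitzWith K (frozenField g) :=
  LipschitzWith.of_dist_le_mul fun a b => by
    rw [frozenField, frozenField, Prod.dist_eq, dist_self]
    exact max_le (hg.dist_le_mul a b) (by positivity)

theorem LipschitzWith.frozen {g : E → W → E} {K : NNReal}
    (hg : LipschitzWith K fun z : E × W => g z.1 z.2) (w : W) :
    LipschitzWith K fun v => g v w :=
  LipschitzWith.of_dist_le_mul fun a b => by
    simpa [Prod.dist_eq] using hg.dist_le_mul (a, w) (b, w)

theorem exists_isParamFlow [CompleteSpace E] {g : E → W → E} {K : NNReal}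
    (hg : LipschitzWith K fun z : E × W => g z.1 z.2) : ∃ φ, IsParamFlow g φ := by
  choose φ h0 hφ using fun (u : E) (w : W) => exists_isIntegralCurveOn_Ici (hg.frozen w) u
  exact ⟨φ, h0, hφ⟩

namespace IsParamFlow

variable {g : E → W → E} {φ : E → W → ℝ → E} {K : NNReal}

theorem curve_prod (hφ : IsParamFlow g φ) (u : E) (w : W) :
    IsIntegralCurveOn (fun t => (φ u w t, w)) (fun _ => frozenField g) (Set.Ici 0) :=
  fun t ht => (hφ.curve u w t ht).prodMk (hasDerivWithinAt_const t _ w)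

/-- With the parameter as an inert coordinate, dependence on `(u, w)` is dependence on the initial
value of one Lipschitz autonomous system. -/
theorem dist_le (hφ : IsParamFlow g φ) (hg : LipschitzWith K fun z : E × W => g z.1 z.2)
    (u u' : E) (w w' : W) {t : ℝ} (ht : 0 ≤ t) :
    dist (φ u w t) (φ u' w' t) ≤ dist (u, w) (u', w') * Real.exp (K * t) := by
  have := (hφ.curve_prod u w).dist_le_mul_exp (lipschitzWith_frozenField hg)
    (hφ.curve_prod u' w') ht
  simp only [hφ.init] at this
  exact (le_max_left _ _).trans this

theorem add (hφ : IsParamFlow g φ) (hg : LipschitzWith K fun z : E × W => g z.1 z.2)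
    (u : E) (w : W) {s t : ℝ} (hs : 0 ≤ s) (ht : 0 ≤ t) :
    φ u w (t + s) = φ (φ u w s) w t :=
  ((hφ.curve u w).shift (c := s) (s' := Set.Ici 0)
    fun r hr => add_nonneg hr hs).eq_of_eq (hg.frozen w) (hφ.curve _ w)
      (by simp [hφ.init]) ht

theorem continuous_initial (hφ : IsParamFlow g φ)
    (hg : LipschitzWith K fun z : E × W => g z.1 z.2) {t : ℝ} (ht : 0 ≤ t) :
    Continuous fun z : E × W => φ z.1 z.2 t :=
  (LipschitzWith.of_dist_le_mul (K := ⟨Real.exp (K * t), (Real.exp_pos _).le⟩) fun a b => by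
    rw [mul_comm]
    exact hφ.dist_le hg a.1 b.1 a.2 b.2 ht).continuous

end IsParamFlow

theorem IsCompact.exists_forall_ge_lt {X : Type*} [TopologicalSpace X] {B : Set X}
    (hB : IsCompact B) {ψ : X → ℝ → ℝ} {ε : ℝ}
    (h : ∀ x ∈ B, ∃ T, ∀ᶠ y in 𝓝 x, ∀ t ≥ T, ψ y t < ε) :
    ∃ T, ∀ x ∈ B, ∀ t ≥ T, ψ x t < ε := by
  refine hB.induction_on (p := fun s => ∃ T, ∀ x ∈ s, ∀ t ≥ T, ψ x t < ε) ⟨0, by simp⟩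
    (fun s s' hs ⟨T, hT⟩ => ⟨T, fun x hx => hT x (hs hx)⟩) ?_ fun x hx => ?_
  · rintro s s' ⟨T, hT⟩ ⟨T', hT'⟩
    refine ⟨max T T', fun x hx t ht => ?_⟩
    rcases hx with hx | hx
    · exact hT x hx t ((le_max_left _ _).trans ht)
    · exact hT' x hx t ((le_max_right _ _).trans ht)
  · obtain ⟨T, hT⟩ := h x hx
    exact ⟨_, mem_nhdsWithin_of_mem_nhds hT, T, fun y hy => hy⟩

namespace IsParamFlow

variable {g : E → W → E} {φ : E → W → ℝ → E} {K : NNReal}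

/-- A trajectory enters the stability ball at some time `T`. By continuity its neighbours are there
at the same `T`, and stability keeps them close afterwards; compactness does the rest. -/
theorem exists_forall_ge_dist_lt_of_isGlobAsympStable [ProperSpace E] (hφ : IsParamFlow g φ)
    (hg : LipschitzWith K fun z : E × W => g z.1 z.2) {w : W} {e : E}
    (he : IsGlobAsympStable (fun v => g v w) e) (r : ℝ) {ε : ℝ} (hε : 0 < ε) :
    ∃ T, ∀ u ∈ Metric.closedBall e r, ∀ t ≥ T, dist (φ u w t) e < ε := by
  refine (isCompact_closedBall e r).exists_forall_ge_lt (ψ := fun u t => dist (φ u w t) e)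
    fun u _ => ?_
  obtain ⟨δ, hδ, hstab⟩ := he.stable ε hε
  obtain ⟨T, hT0, hT⟩ : ∃ T, 0 ≤ T ∧ dist (φ u w T) e < δ :=
    ((eventually_ge_atTop 0).and
      ((he.attractive _ (hφ.curve u w)).eventually (Metric.ball_mem_nhds e hδ))).exists
  refine ⟨T, ?_⟩
  have hc : Continuous fun v => dist (φ v w T) e :=
    ((hφ.continuous_initial hg hT0).comp (by fun_prop : Continuous fun v : E => (v, w))).dist
      continuous_const
  filter_upwards [hc.continuousAt.eventually (gt_mem_nhds hT)] with v hv t ht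
  have h1 := hstab (φ (φ v w T) w) (hφ.curve _ w)
    (by rwa [hφ.init, ← dist_eq_norm]) (t - T) (by linarith)
  rw [← hφ.add hg v w hT0 (by linarith), sub_add_cancel] at h1
  rwa [dist_eq_norm]

/-- Lyapunov stability persists, up to an arbitrarily small error, under small perturbations of the
parameter. -/
theorem exists_trapping [ProperSpace E] (hφ : IsParamFlow g φ)
    (hg : LipschitzWith K fun z : E × W => g z.1 z.2) {w : W} {e : E}
    (he : IsGlobAsympStable (fun v => g v w) e) {ε : ℝ} (hε : 0 < ε) :
    ∃ δ > 0, ∃ η > 0, ∀ w', dist w' w < η → ∀ u, dist u e < δ →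
      ∀ t ≥ 0, dist (φ u w' t) e < ε := by
  obtain ⟨δ, hδ, hstab⟩ := he.stable (ε / 2) (half_pos hε)
  obtain ⟨T₀, hT₀⟩ := hφ.exists_forall_ge_dist_lt_of_isGlobAsympStable hg he δ (half_pos hδ)
  set T := max T₀ 1 with hT
  have hTpos : 0 < T := lt_max_of_lt_right one_pos
  set ρ := min (δ / 2) (ε / 2) with hρ
  have hρ0 : 0 < ρ := lt_min (half_pos hδ) (half_pos hε)
  -- Chosen so that the Gronwall factor over `[0, T]` turns a parameter gap below `η` into a
  -- trajectory gap below `ρ`.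
  set η := ρ * Real.exp (-(K * T)) with hη
  refine ⟨δ, hδ, η, by positivity, fun w' hw' => ?_⟩
  have hclose : ∀ u, ∀ t, 0 ≤ t → t ≤ T → dist (φ u w' t) (φ u w t) < ρ := by
    intro u t ht htT
    refine (hφ.dist_le hg u u w' w ht).trans_lt ?_
    have h1 : dist (u, w') (u, w) = dist w' w := by simp [Prod.dist_eq]
    rw [h1]
    calc dist w' w * Real.exp (K * t) ≤ dist w' w * Real.exp (K * T) := by gcongr
      _ < η * Real.exp (K * T) := by gcongr
      _ = ρ := by rw [hη, mul_assoc, ← Real.exp_add]; simp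
  have hstay : ∀ u, dist u e < δ → ∀ t, 0 ≤ t → t ≤ T → dist (φ u w' t) e < ε := by
    intro u hu t ht htT
    have h1 := hstab (φ u w) (hφ.curve u w) (by rwa [hφ.init, ← dist_eq_norm]) t ht
    rw [← dist_eq_norm] at h1
    have h2 := (hclose u t ht htT).trans_le (min_le_right _ _)
    linarith [dist_triangle (φ u w' t) (φ u w t) e]
  -- The unperturbed flow maps the `δ`-ball into the `δ / 2`-ball by time `T`, so the perturbed one
  -- maps it into itself. Iterating reduces the infinite horizon to windows of length `T`.
  have hreturn : ∀ u, dist u e < δ → dist (φ u w' T) e < δ := by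
    intro u hu
    have h1 := hT₀ u hu.le T (le_max_left _ _)
    have h2 := (hclose u T hTpos.le le_rfl).trans_le (min_le_left _ _)
    linarith [dist_triangle (φ u w' T) (φ u w T) e]
  have hiter : ∀ k : ℕ, ∀ u, dist u e < δ → dist (φ u w' (k * T)) e < δ := by
    intro k
    induction k with
    | zero => intro u hu; simpa [hφ.init] using hu
    | succ k ih =>
      intro u hu
      have := ih _ (hreturn u hu)
      rwa [← hφ.add hg u w' hTpos.le (by positivity),
        show (k : ℝ) * T + T = ((k + 1 : ℕ) : ℝ) * T by push_cast; ring] at this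
  intro u hu t ht
  have hk1 : (⌊t / T⌋₊ : ℝ) * T ≤ t := (le_div_iff₀ hTpos).1 (Nat.floor_le (by positivity))
  have hk2 : t < (⌊t / T⌋₊ + 1 : ℝ) * T := (div_lt_iff₀ hTpos).1 (Nat.lt_floor_add_one _)
  have := hstay _ (hiter ⌊t / T⌋₊ u hu) (t - ⌊t / T⌋₊ * T) (by linarith) (by linarith)
  rwa [← hφ.add hg u w' (by positivity) (by linarith), sub_add_cancel] at this

/-- Globally asymptotically stable equilibria depending continuously on a parameter attract
uniformly on compact sets of initial values and parameters. -/
theorem exists_forall_ge_dist_lt [ProperSpace E] (hφ : IsParamFlow g φ)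
    (hg : LipschitzWith K fun z : E × W => g z.1 z.2) {lam : W → E} (hlam : Continuous lam)
    (he : ∀ w, IsGlobAsympStable (fun v => g v w) (lam w)) {B : Set (E × W)} (hB : IsCompact B)
    {ε : ℝ} (hε : 0 < ε) :
    ∃ T, ∀ z ∈ B, ∀ t ≥ T, dist (φ z.1 z.2 t) (lam z.2) < ε := by
  refine hB.exists_forall_ge_lt (ψ := fun z t => dist (φ z.1 z.2 t) (lam z.2)) ?_
  rintro ⟨u, w⟩ -
  -- Trapping replaces Lyapunov stability, as nearby parameters have different equilibria; the other
  -- `ε / 2` pays for the variation of `lam`.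
  obtain ⟨δ, hδ, η, hη, htrap⟩ := hφ.exists_trapping hg (he w) (half_pos hε)
  obtain ⟨T, hT0, hT⟩ : ∃ T, 0 ≤ T ∧ dist (φ u w T) (lam w) < δ :=
    ((eventually_ge_atTop 0).and
      (((he w).attractive _ (hφ.curve u w)).eventually (Metric.ball_mem_nhds _ hδ))).exists
  refine ⟨T, ?_⟩
  have hc : Continuous fun z : E × W => dist (φ z.1 z.2 T) (lam w) :=
    (hφ.continuous_initial hg hT0).dist continuous_const
  have hl : ∀ᶠ z : E × W in 𝓝 (u, w), dist (lam z.2) (lam w) < ε / 2 :=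
    ((hlam.comp continuous_snd).tendsto (u, w)).eventually
      (Metric.ball_mem_nhds ((lam ∘ Prod.snd) (u, w)) (half_pos hε))
  have hw : ∀ᶠ z : E × W in 𝓝 (u, w), dist z.2 w < η :=
    (continuous_snd.tendsto (u, w)).eventually (Metric.ball_mem_nhds w hη)
  filter_upwards [hc.continuousAt.eventually (gt_mem_nhds hT), hl, hw] with z h1 h2 h3 t ht
  have h4 := htrap z.2 h3 (φ z.1 z.2 T) h1 (t - T) (by linarith)
  rw [← hφ.add hg z.1 z.2 hT0 (by linarith), sub_add_cancel] at h4
  linarith [dist_triangle_right (φ z.1 z.2 t) (lam z.2) (lam w)]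

end IsParamFlow

end UniformAttraction

/-! ### Perturbed Euler schemes shadow the flow. -/

section Tracking

/-- The time elapsed after `n` steps of sizes `a 0, a 1, …`. -/
noncomputable def elapsed (a : ℕ → ℝ) (n : ℕ) : ℝ := ∑ k ∈ Finset.range n, a k

theorem elapsed_succ (a : ℕ → ℝ) (n : ℕ) : elapsed a (n + 1) = elapsed a n + a n :=
  Finset.sum_range_succ a n

theorem elapsed_mono {a : ℕ → ℝ} (ha : ∀ n, 0 < a n) : Monotone (elapsed a) :=
  monotone_nat_of_le_succ fun n => by rw [elapsed_succ]; linarith [ha n]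

theorem exists_elapsed_window {a : ℕ → ℝ} (ha0 : Tendsto a atTop (𝓝 0))
    (hsum : Tendsto (elapsed a) atTop atTop) (T : ℝ) (hT : 0 ≤ T) (n₀ : ℕ) :
    ∀ᶠ m in atTop, ∃ n ≥ n₀, n ≤ m ∧ T ≤ elapsed a m - elapsed a n ∧
      elapsed a m - elapsed a n ≤ T + 1 := by
  obtain ⟨n₁, hn₁⟩ := eventually_atTop.1 (ha0.eventually (gt_mem_nhds one_pos))
  set N := max n₀ n₁ with hN
  filter_upwards [hsum.eventually_ge_atTop (elapsed a N + T), eventually_ge_atTop N] with m hm hNm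
  classical
  set P : ℕ → Prop := fun n => elapsed a n ≤ elapsed a m - T with hP
  have hPN : P N := by simp only [hP]; linarith
  -- The last index at least `T` before `m`; the overshoot is less than one step, and steps beyond
  -- `N` are shorter than 1.
  set n := Nat.findGreatest P m with hn
  have hspec : P n := Nat.findGreatest_spec hNm hPN
  have hNn : N ≤ n := Nat.le_findGreatest hNm hPN
  have hnm : n ≤ m := Nat.findGreatest_le m
  refine ⟨n, (le_max_left _ _).trans hNn, hnm, by simp only [hP] at hspec; linarith, ?_⟩
  rcases hnm.eq_or_lt with h | h
  · rw [h]; linarith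
  · have h1 : ¬ P (n + 1) := Nat.findGreatest_is_greatest (Nat.lt_succ_self n) h
    simp only [hP, elapsed_succ, not_le] at h1
    linarith [hn₁ n ((le_max_right _ _).trans hNn)]

variable {Z : Type*} [NormedAddCommGroup Z] [NormedSpace ℝ Z]

/-- Single noise increments need not be small relative to `a k`; only their sums are. Hence the
discrete Gronwall argument runs on the error minus `S k - S n`. Per unit time, `K * δ` comes from
this shift inside `F`, `δ` from `ε`, and `K * C * η` from the Euler error. -/
theorem norm_sub_flow_le {F : Z → Z} {K : NNReal} (hF : LipschitzWith K F) {y : ℝ → Z}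
    (hy : IsIntegralCurveOn y (fun _ => F) (Set.Ici 0)) {a : ℕ → ℝ} (ha : ∀ n, 0 < a n)
    {z ε S : ℕ → Z} (hz : ∀ n, z (n + 1) = z n + a n • (F (z n) + ε n) + (S (n + 1) - S n))
    {n m : ℕ} (hnm : n ≤ m) (hy0 : y 0 = z n) {T C δ η : ℝ}
    (hT : elapsed a m - elapsed a n ≤ T) (hC : ∀ t ∈ Set.Icc 0 T, ‖F (y t)‖ ≤ C)
    (hε : ∀ k ≥ n, ‖ε k‖ ≤ δ) (hS : ∀ k ≥ n, ‖S k - S n‖ ≤ δ) (haη : ∀ k ≥ n, a k ≤ η) :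
    ‖z m - y (elapsed a m - elapsed a n)‖ ≤
      (K * δ + δ + K * C * η) * T * Real.exp (K * T) + δ := by
  have hmono := elapsed_mono ha
  have hT0 : 0 ≤ T := (sub_nonneg.2 (hmono hnm)).trans hT
  have hδ : 0 ≤ δ := (norm_nonneg _).trans (hS n le_rfl)
  have hη : 0 ≤ η := (ha n).le.trans (haη n le_rfl)
  have hC0 : 0 ≤ C := (norm_nonneg _).trans (hC 0 ⟨le_rfl, hT0⟩)
  have hK := K.coe_nonneg
  set ρ := K * δ + δ + K * C * η with hρ
  have hρ0 : 0 ≤ ρ := by positivity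
  have key : ∀ k, n ≤ k → k ≤ m → ‖z k - y (elapsed a k - elapsed a n) - (S k - S n)‖ ≤
      ρ * (elapsed a k - elapsed a n) * Real.exp (K * (elapsed a k - elapsed a n)) := by
    intro k hk
    induction k, hk using Nat.le_induction with
    | base => intro _; simp [hy0]
    | succ k hk ih =>
      intro hkm
      have ihk := ih (by omega)
      have hs0 : 0 ≤ elapsed a k - elapsed a n := sub_nonneg.2 (hmono hk)
      have hsT : elapsed a (k + 1) - elapsed a n ≤ T := by linarith [hmono hkm]
      have hsucc : elapsed a (k + 1) - elapsed a n = elapsed a k - elapsed a n + a k := by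
        rw [elapsed_succ]; ring
      rw [hsucc] at hsT ⊢
      set s := elapsed a k - elapsed a n with hs
      have hak := ha k
      have hr := hy.norm_euler_error_le hF hs0 hak.le
        (fun t ht => hC t ⟨hs0.trans ht.1, ht.2.trans hsT⟩)
      have hdecomp : z (k + 1) - y (s + a k) - (S (k + 1) - S n) =
          (z k - y s - (S k - S n)) + a k • (F (z k) - F (y s)) + a k • ε k -
            (y (s + a k) - y s - a k • F (y s)) := by
        rw [hz k, smul_add, smul_sub]; abel
      have h1 : ‖z k - y s‖ ≤ ‖z k - y s - (S k - S n)‖ + δ := by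
        have := norm_add_le (z k - y s - (S k - S n)) (S k - S n)
        rw [sub_add_cancel] at this
        linarith [hS k hk]
      have h2 : ‖a k • (F (z k) - F (y s))‖ ≤
          a k * (K * (‖z k - y s - (S k - S n)‖ + δ)) := by
        rw [norm_smul, Real.norm_of_nonneg hak.le]
        gcongr
        exact (hF.norm_sub_le _ _).trans (by gcongr)
      have h3 : ‖a k • ε k‖ ≤ a k * δ := by
        rw [norm_smul, Real.norm_of_nonneg hak.le]
        gcongr
        exact hε k hk
      have h4 : ↑K * C * a k * a k ≤ a k * (K * C * η) := by
        have : ↑K * C * a k ≤ K * C * η := by gcongr; exact haη k hk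
        calc ↑K * C * a k * a k ≤ K * C * η * a k := by gcongr
          _ = a k * (K * C * η) := by ring
      rw [hdecomp]
      set X := ‖z k - y s - (S k - S n)‖ with hX
      have h5 : ‖(z k - y s - (S k - S n)) + a k • (F (z k) - F (y s)) + a k • ε k -
            (y (s + a k) - y s - a k • F (y s))‖ ≤ (1 + a k * K) * X + a k * ρ := by
        refine (norm_sub_le _ _).trans ?_
        have h6 := norm_add_le (z k - y s - (S k - S n) + a k • (F (z k) - F (y s))) (a k • ε k)
        have h7 := norm_add_le (z k - y s - (S k - S n)) (a k • (F (z k) - F (y s)))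
        rw [hρ]
        nlinarith
      refine h5.trans ?_
      have h8 : 1 + a k * K ≤ Real.exp (K * a k) := by
        linarith [Real.add_one_le_exp (K * a k), mul_comm (a k) (K : ℝ)]
      calc (1 + a k * K) * X + a k * ρ
          ≤ Real.exp (K * a k) * (ρ * s * Real.exp (K * s)) +
            a k * ρ * Real.exp (K * (s + a k)) := by
            have : 1 ≤ Real.exp (K * (s + a k)) := Real.one_le_exp (by positivity)
            have := le_mul_of_one_le_right (by positivity : 0 ≤ a k * ρ) this
            gcongr
        _ = ρ * (s + a k) * Real.exp (K * (s + a k)) := by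
            rw [mul_add (K : ℝ), Real.exp_add]; ring
  have h1 := key m hnm le_rfl
  have h2 := norm_add_le (z m - y (elapsed a m - elapsed a n) - (S m - S n)) (S m - S n)
  rw [sub_add_cancel] at h2
  have h3 : ρ * (elapsed a m - elapsed a n) * Real.exp (K * (elapsed a m - elapsed a n)) ≤
      ρ * T * Real.exp (K * T) := by gcongr
  linarith [hS m hnm]

/-- The iterates of a perturbed Euler scheme follow the flow on windows of bounded length. -/
theorem exists_forall_dist_flow_lt {F : Z → Z} {K : NNReal} (hF : LipschitzWith K F)
    {Φ : Z → ℝ → Z} (hΦ0 : ∀ p, Φ p 0 = p)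
    (hΦ : ∀ p, IsIntegralCurveOn (Φ p) (fun _ => F) (Set.Ici 0))
    {a : ℕ → ℝ} (ha : ∀ n, 0 < a n) (ha0 : Tendsto a atTop (𝓝 0))
    {z ε S : ℕ → Z} (hz : ∀ n, z (n + 1) = z n + a n • (F (z n) + ε n) + (S (n + 1) - S n))
    {R : ℝ} (hR : ∀ n, ‖z n‖ ≤ R) (hε : Tendsto ε atTop (𝓝 0)) {s : Z}
    (hS : Tendsto S atTop (𝓝 s)) (T : ℝ) {ρ : ℝ} (hρ : 0 < ρ) :
    ∃ n₀, ∀ n ≥ n₀, ∀ m ≥ n, elapsed a m - elapsed a n ≤ T →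
      dist (z m) (Φ (z n) (elapsed a m - elapsed a n)) < ρ := by
  set C₀ := ‖F 0‖ + K * R with hC₀
  have hFz : ∀ n, ‖F (z n)‖ ≤ C₀ := fun n => by
    have h1 := hF.norm_sub_le (z n) 0
    rw [sub_zero] at h1
    have h2 := norm_add_le (F (z n) - F 0) (F 0)
    rw [sub_add_cancel] at h2
    have h3 := mul_le_mul_of_nonneg_left (hR n) K.coe_nonneg
    linarith
  set C := C₀ + K * gronwallBound 0 K C₀ T with hC
  have hFy : ∀ n, ∀ t ∈ Set.Icc 0 T, ‖F (Φ (z n) t)‖ ≤ C := fun n t ht => by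
    have h0 := (hΦ (z n)).dist_initial_le hF (C := C₀) (by rw [hΦ0]; exact hFz n) ht.1 ht.2
    rw [hΦ0, dist_eq_norm] at h0
    have h1 := hF.norm_sub_le (Φ (z n) t) (z n)
    have h2 := norm_add_le (F (Φ (z n) t) - F (z n)) (F (z n))
    rw [sub_add_cancel] at h2
    have h3 := mul_le_mul_of_nonneg_left h0 K.coe_nonneg
    linarith [hFz n]
  -- The total error is continuous in `δ` and vanishes at 0; one `δ` controls `ε`, the noise and the
  -- step sizes.
  obtain ⟨δ, hδ, hδρ⟩ : ∃ δ > 0,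
      (K * δ + δ + K * C * δ) * T * Real.exp (K * T) + δ < ρ := by
    have hcont : Continuous fun δ : ℝ =>
        (K * δ + δ + K * C * δ) * T * Real.exp (K * T) + δ := by fun_prop
    have h1 : ∀ᶠ δ in 𝓝[>] (0 : ℝ),
        (K * δ + δ + K * C * δ) * T * Real.exp (K * T) + δ < ρ :=
      (hcont.tendsto' 0 0 (by simp)).mono_left nhdsWithin_le_nhds |>.eventually (gt_mem_nhds hρ)
    obtain ⟨δ, h2, h3⟩ := (h1.and self_mem_nhdsWithin).exists
    exact ⟨δ, h3, h2⟩
  obtain ⟨n₁, hn₁⟩ := eventually_atTop.1 (ha0.eventually (gt_mem_nhds hδ))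
  obtain ⟨n₂, hn₂⟩ := eventually_atTop.1 (hε.eventually (Metric.ball_mem_nhds 0 hδ))
  obtain ⟨n₃, hn₃⟩ := Metric.cauchySeq_iff.1 hS.cauchySeq δ hδ
  refine ⟨max n₁ (max n₂ n₃), fun n hn m hm hTm => ?_⟩
  simp only [ge_iff_le, max_le_iff] at hn
  rw [dist_eq_norm]
  refine (norm_sub_flow_le hF (hΦ (z n)) ha hz hm (hΦ0 _) hTm (hFy n) (fun k hk => ?_)
    (fun k hk => ?_) (fun k hk => (hn₁ k (hn.1.trans hk)).le)).trans_lt hδρ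
  · simpa using (hn₂ k (hn.2.1.trans hk)).le
  · simpa [dist_eq_norm] using (hn₃ k (hn.2.2.trans hk) n hn.2.2).le

/-- Tracking of an equilibrium which depends on slowly varying parameters. -/
theorem tendsto_sub_equilibrium {E W : Type*} [NormedAddCommGroup E] [NormedSpace ℝ E]
    [ProperSpace E] [NormedAddCommGroup W] [NormedSpace ℝ W] [ProperSpace W]
    {g : E → W → E} {K : NNReal} (hg : LipschitzWith K fun z : E × W => g z.1 z.2)
    {lam : W → E} {L : NNReal} (hlam : LipschitzWith L lam)
    (he : ∀ w, IsGlobAsympStable (fun v => g v w) (lam w))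
    {a : ℕ → ℝ} (ha : ∀ n, 0 < a n) (ha0 : Tendsto a atTop (𝓝 0))
    (hsum : Tendsto (elapsed a) atTop atTop)
    {u ε S : ℕ → E} {w ε' S' : ℕ → W}
    (hu : ∀ n, u (n + 1) = u n + a n • (g (u n) (w n) + ε n) + (S (n + 1) - S n))
    (hw : ∀ n, w (n + 1) = w n + a n • ε' n + (S' (n + 1) - S' n))
    {R : ℝ} (huR : ∀ n, ‖u n‖ ≤ R) (hwR : ∀ n, ‖w n‖ ≤ R)
    (hε : Tendsto ε atTop (𝓝 0)) (hε' : Tendsto ε' atTop (𝓝 0))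
    {s : E} (hS : Tendsto S atTop (𝓝 s)) {s' : W} (hS' : Tendsto S' atTop (𝓝 s')) :
    Tendsto (fun n => u n - lam (w n)) atTop (𝓝 0) := by
  obtain ⟨φ, hφ⟩ := exists_isParamFlow hg
  rw [Metric.tendsto_nhds]
  intro r hr
  obtain ⟨T₀, hT₀⟩ := hφ.exists_forall_ge_dist_lt hg hlam.continuous he
    (isCompact_closedBall (0 : E × W) R) (by positivity : 0 < r / 3)
  set T := max T₀ 0 with hT
  have hT0 : 0 ≤ T := le_max_right _ _
  -- The shadowing error counts once in `u` and `L` times through `lam`, which makes `r / 3` in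
  -- total.
  set ρ := r / (3 * (L + 1)) with hρ
  have hρ0 : 0 < ρ := by positivity
  have hLρ : (L + 1) * ρ = r / 3 := by rw [hρ]; field_simp
  have hzR : ∀ n, ‖(u n, w n)‖ ≤ R := fun n => max_le (huR n) (hwR n)
  -- The pair `(u, w)` is a perturbed scheme for the frozen field, the whole drift of `w` being
  -- error. Windows reach `T + 1` to allow for the overshoot.
  obtain ⟨n₀, hn₀⟩ := exists_forall_dist_flow_lt (lipschitzWith_frozenField hg)
    (Φ := fun p t => (φ p.1 p.2 t, p.2)) (fun p => by simp [hφ.init])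
    (fun p => hφ.curve_prod p.1 p.2) ha ha0 (z := fun n => (u n, w n))
    (ε := fun n => (ε n, ε' n)) (S := fun n => (S n, S' n))
    (fun n => by simp [hu n, hw n, frozenField]) hzR
    (hε.prodMk_nhds hε') (hS.prodMk_nhds hS')
    (T + 1) hρ0
  filter_upwards [exists_elapsed_window ha0 hsum T hT0 n₀] with m ⟨n, hn, hnm, h1, h2⟩
  have h3 := hn₀ n hn m hnm h2
  rw [Prod.dist_eq, max_lt_iff] at h3
  have h4 := hT₀ (u n, w n) (by simpa using hzR n) _ ((le_max_left _ _).trans h1)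
  have h5 := hlam.dist_le_mul (w m) (w n)
  have h6 : (L : ℝ) * dist (w m) (w n) ≤ L * ρ := by gcongr; exact h3.2.le
  have h7 := h3.1
  simp only at h4 h7
  rw [dist_zero_right, ← dist_eq_norm]
  have h8 := dist_triangle4 (u m) (φ (u n) (w n) (elapsed a m - elapsed a n)) (lam (w n))
    (lam (w m))
  rw [dist_comm (lam (w n))] at h8
  linarith

end Tracking

/-! ### Almost sure convergence of the weighted noise. -/

section Noise

variable {Ω : Type*} [mΩ : MeasurableSpace Ω] {P : Measure Ω} [IsProbabilityMeasure P]

/-- A martingale with summable second moments of the increments converges almost surely. -/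
theorem ae_exists_tendsto_sum_of_condExp_eq_zero {ℱ : Filtration ℕ mΩ} {ξ : ℕ → Ω → ℝ}
    (hmeas : ∀ k, StronglyMeasurable[ℱ (k + 1)] (ξ k)) (hL2 : ∀ k, MemLp (ξ k) 2 P)
    (hmart : ∀ k, P[ξ k | ℱ k] =ᵐ[P] 0) {C : ℝ}
    (hC : ∀ n, ∑ k ∈ Finset.range n, ∫ ω, ξ k ω ^ 2 ∂P ≤ C) :
    ∀ᵐ ω ∂P, ∃ s, Tendsto (fun n => ∑ k ∈ Finset.range n, ξ k ω) atTop (𝓝 s) := by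
  set f : ℕ → Ω → ℝ := fun n => ∑ k ∈ Finset.range n, ξ k with hf
  have hsucc : ∀ n, f (n + 1) = f n + ξ n := fun n => Finset.sum_range_succ _ _
  have hfm : StronglyAdapted ℱ f := fun n =>
    Finset.stronglyMeasurable_sum _ fun k hk =>
      (hmeas k).mono (ℱ.mono (Nat.succ_le_of_lt (Finset.mem_range.1 hk)))
  have hfL2 : ∀ n, MemLp (f n) 2 P := fun n => memLp_finsetSum' _ fun k _ => hL2 k
  have hfint : ∀ n, Integrable (f n) P := fun n => (hfL2 n).integrable one_le_two
  have hξint : ∀ n, Integrable (ξ n) P := fun n => (hL2 n).integrable one_le_two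
  have hM : Martingale f ℱ P := martingale_of_condExp_sub_eq_zero_nat hfm hfint fun n => by
    rw [hsucc, add_sub_cancel_left]
    exact hmart n
  -- Increments are orthogonal to the past, so second moments add up; with `|f| ≤ 1 + f ^ 2` this
  -- gives the L¹ bound for martingale convergence.
  have horth : ∀ n, ∫ ω, f n ω * ξ n ω ∂P = 0 := fun n => by
    have h1 : P[f n * ξ n | ℱ n] =ᵐ[P] f n * P[ξ n | ℱ n] :=
      condExp_mul_of_stronglyMeasurable_left (hfm n) ((hfL2 n).integrable_mul (hL2 n)) (hξint n)
    have h2 : P[f n * ξ n | ℱ n] =ᵐ[P] 0 := by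
      filter_upwards [h1, hmart n] with ω h3 h4
      simp [h3, h4]
    have h5 := integral_condExp (f := f n * ξ n) (μ := P) (ℱ.le n)
    rw [integral_congr_ae h2] at h5
    simpa using h5.symm
  have hsq : ∀ n, ∫ ω, f n ω ^ 2 ∂P = ∑ k ∈ Finset.range n, ∫ ω, ξ k ω ^ 2 ∂P := by
    intro n
    induction n with
    | zero => simp [hf]
    | succ n ih =>
      have h1 : ∀ ω, f (n + 1) ω ^ 2 = f n ω ^ 2 + (2 * (f n ω * ξ n ω) + ξ n ω ^ 2) := fun ω => by
        rw [hsucc, Pi.add_apply]; ring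
      have hi : Integrable (fun ω => f n ω * ξ n ω) P := (hfL2 n).integrable_mul (hL2 n)
      have hi2 : Integrable (fun ω => 2 * (f n ω * ξ n ω) + ξ n ω ^ 2) P :=
        (hi.const_mul 2).add (hL2 n).integrable_sq
      simp_rw [h1]
      rw [integral_add (hfL2 n).integrable_sq hi2,
        integral_add (hi.const_mul 2) (hL2 n).integrable_sq, integral_const_mul, horth, ih,
        Finset.sum_range_succ]
      ring
  have hbdd : ∀ n, eLpNorm (f n) 1 P ≤ (Real.toNNReal (1 + C) : ℝ≥0∞) := fun n => by
    rw [eLpNorm_one_eq_lintegral_enorm, ← ofReal_integral_norm_eq_lintegral_enorm (hfint n)]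
    refine ENNReal.ofReal_le_ofReal ?_
    calc ∫ ω, ‖f n ω‖ ∂P ≤ ∫ ω, (1 + f n ω ^ 2) ∂P := by
          refine integral_mono (hfint n).norm ((integrable_const 1).add (hfL2 n).integrable_sq)
            fun ω => ?_
          simp only [Real.norm_eq_abs]
          nlinarith [sq_abs (f n ω), sq_nonneg (|f n ω| - 1), abs_nonneg (f n ω)]
      _ = 1 + ∫ ω, f n ω ^ 2 ∂P := by
          rw [integral_add (integrable_const 1) (hfL2 n).integrable_sq]; simp
      _ ≤ 1 + C := by rw [hsq]; linarith [hC n]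
  filter_upwards [hM.submartingale.exists_ae_tendsto_of_bdd hbdd] with ω hω
  simpa [hf] using hω

/-- Weighted sums of martingale differences converge almost surely on the event that a predictable
process controlling the second moments stays bounded. -/
theorem ae_exists_tendsto_sum_smul {ι : Type*} [Fintype ι] {ℱ : Filtration ℕ mΩ}
    {α : ℕ → ℝ} (hα : Summable fun n => α n ^ 2) {M : ℕ → Ω → EuclideanSpace ℝ ι}
    (hmeas : ∀ k, Measurable[ℱ (k + 1)] (M k)) (hint : ∀ k, Integrable (M k) P)
    (hmart : ∀ k, P[M k | ℱ k] =ᵐ[P] 0) {X : ℕ → Ω → ℝ} (hX : ∀ k, Measurable[ℱ k] (X k))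
    (hvar : ∀ c : ℕ, ∃ B : ℝ, 0 ≤ B ∧
      ∀ k, ∫⁻ ω in {ω | X k ω ≤ c}, ‖M k ω‖ₑ ^ 2 ∂P ≤ ENNReal.ofReal B) :
    ∀ᵐ ω ∂P, BddAbove (Set.range fun n => X n ω) →
      ∃ s, Tendsto (fun n => ∑ k ∈ Finset.range n, α k • M k ω) atTop (𝓝 s) := by
  classical
  set A : ℕ → ℕ → Set Ω := fun c k => {ω | X k ω ≤ c} with hA
  have hAmeas : ∀ c k, MeasurableSet[ℱ k] (A c k) := fun c k => hX k measurableSet_Iic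
  -- The event `X k ≤ c` is known at time `k`, so truncating to it keeps the martingale difference
  -- property and makes second moments summable.
  set ξ : ι → ℕ → ℕ → Ω → ℝ := fun l c k => (A c k).indicator fun ω => α k * M k ω l with hξ
  have hproj : ∀ l k, Integrable (fun ω => α k * M k ω l) P := fun l k =>
    ((EuclideanSpace.proj (𝕜 := ℝ) l).integrable_comp (hint k)).const_mul (α k)
  have hcomp : ∀ l k, Measurable[ℱ (k + 1)] fun ω => α k * M k ω l := fun l k =>
    Measurable.const_mul
      ((EuclideanSpace.proj (𝕜 := ℝ) l).continuous.measurable.comp (hmeas k)) (α k)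
  have hξmeas : ∀ l c k, Measurable[ℱ (k + 1)] (ξ l c k) := fun l c k =>
    (hcomp l k).indicator (ℱ.mono k.le_succ _ (hAmeas c k))
  have hξmart : ∀ l c k, P[ξ l c k | ℱ k] =ᵐ[P] 0 := fun l c k => by
    have h1 := condExp_indicator (hproj l k) (hAmeas c k)
    have h2 := (α k • EuclideanSpace.proj (𝕜 := ℝ) l).comp_condExp_comm (hint k) (m := ℱ k)
    have h3 : (α k • EuclideanSpace.proj (𝕜 := ℝ) l) ∘ M k = fun ω => α k * M k ω l := by
      ext ω; simp
    rw [h3] at h2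
    filter_upwards [h1, h2, hmart k] with ω h4 h5 h6
    rw [h4]
    simp only [Set.indicator_apply, Pi.zero_apply, ite_eq_right_iff]
    intro _
    rw [← h5]
    simp [h6]
  have hξsq : ∀ l (c k : ℕ), ∀ B : ℝ, 0 ≤ B →
      ∫⁻ ω in {ω | X k ω ≤ c}, ‖M k ω‖ₑ ^ 2 ∂P ≤ ENNReal.ofReal B →
      ∫⁻ ω, ‖ξ l c k ω‖ₑ ^ 2 ∂P ≤ ENNReal.ofReal (α k ^ 2 * B) := fun l c k B hB hle => by
    have hpt : ∀ ω, ‖ξ l c k ω‖ₑ ^ 2 ≤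
        (A c k).indicator (fun ω => ENNReal.ofReal (α k ^ 2) * ‖M k ω‖ₑ ^ 2) ω := fun ω => by
      by_cases hω : ω ∈ A c k
      · simp only [hξ, Set.indicator_of_mem hω]
        rw [enorm_mul, mul_pow]
        gcongr
        · rw [Real.enorm_eq_ofReal_abs, ← ENNReal.ofReal_pow (abs_nonneg _), sq_abs]
        · exact enorm_le_iff_norm_le.2 (PiLp.norm_apply_le (M k ω) l)
      · simp [hξ, Set.indicator_of_notMem hω]
    calc ∫⁻ ω, ‖ξ l c k ω‖ₑ ^ 2 ∂P
        ≤ ∫⁻ ω, (A c k).indicator (fun ω => ENNReal.ofReal (α k ^ 2) * ‖M k ω‖ₑ ^ 2) ω ∂P :=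
          lintegral_mono hpt
      _ = ENNReal.ofReal (α k ^ 2) * ∫⁻ ω in A c k, ‖M k ω‖ₑ ^ 2 ∂P := by
          rw [lintegral_indicator (ℱ.le k _ (hAmeas c k)),
            lintegral_const_mul' _ _ ENNReal.ofReal_ne_top]
      _ ≤ ENNReal.ofReal (α k ^ 2 * B) := by
          rw [ENNReal.ofReal_mul (sq_nonneg _)]
          gcongr
  have hconv : ∀ l c, ∀ᵐ ω ∂P,
      ∃ s, Tendsto (fun n => ∑ k ∈ Finset.range n, ξ l c k ω) atTop (𝓝 s) := fun l c => by
    obtain ⟨B, hB, hle⟩ := hvar c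
    have hL2 : ∀ k, MemLp (ξ l c k) 2 P := fun k => by
      refine ⟨((hξmeas l c k).mono (ℱ.le _) le_rfl).aestronglyMeasurable, ?_⟩
      rw [eLpNorm_lt_top_iff_lintegral_rpow_enorm_lt_top two_ne_zero ENNReal.ofNat_ne_top]
      simpa using (hξsq l c k B hB (hle k)).trans_lt ENNReal.ofReal_lt_top
    refine ae_exists_tendsto_sum_of_condExp_eq_zero (C := (∑' k, α k ^ 2) * B)
      (fun k => (hξmeas l c k).stronglyMeasurable) hL2 (hξmart l c) fun n => ?_
    have hk : ∀ k, ∫ ω, ξ l c k ω ^ 2 ∂P ≤ α k ^ 2 * B := fun k => by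
      rw [integral_eq_lintegral_of_nonneg_ae (ae_of_all _ fun ω => sq_nonneg _)
        (hL2 k).integrable_sq.aestronglyMeasurable]
      refine ENNReal.toReal_le_of_le_ofReal (by positivity) ?_
      refine le_trans (le_of_eq (lintegral_congr fun ω => ?_)) (hξsq l c k B hB (hle k))
      rw [Real.enorm_eq_ofReal_abs, ← ENNReal.ofReal_pow (abs_nonneg _), sq_abs]
    calc ∑ k ∈ Finset.range n, ∫ ω, ξ l c k ω ^ 2 ∂P
        ≤ ∑ k ∈ Finset.range n, α k ^ 2 * B := Finset.sum_le_sum fun k _ => hk k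
      _ = (∑ k ∈ Finset.range n, α k ^ 2) * B := by rw [Finset.sum_mul]
      _ ≤ _ := by
          gcongr
          exact hα.sum_le_tsum _ fun k _ => sq_nonneg _
  filter_upwards [ae_all_iff.2 fun l => ae_all_iff.2 (hconv l)] with ω hω hbdd
  -- Once `c` exceeds the bound on this path, no truncation is active; integer levels suffice, so
  -- only countably many null sets are discarded.
  obtain ⟨b, hb⟩ := hbdd
  obtain ⟨c, hc⟩ := exists_nat_ge b
  choose s hs using fun l => hω l c
  refine ⟨WithLp.toLp 2 s, ?_⟩
  have hmem : ∀ k, ω ∈ A c k := fun k => (hb ⟨k, rfl⟩).trans hc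
  have h1 : Tendsto (fun n => fun l => ∑ k ∈ Finset.range n, ξ l c k ω) atTop (𝓝 s) :=
    tendsto_pi_nhds.2 hs
  refine ((PiLp.continuous_toLp 2 _).tendsto s |>.comp h1).congr fun n => ?_
  ext l
  simp [hξ, Set.indicator_of_mem (hmem _), WithLp.ofLp_sum]

end Noise

/-! ### Pathwise induction over the timescales. -/

section Levels

variable {N : ℕ} {d : Fin N → ℕ} {h : ∀ j : Fin N, State d → Block d j}
  {lam : ∀ i : Fin N, SlowerState d i → Block d i}

/-- Nested substitution at level `i` is Lipschitz in the entries with index at least `i`. -/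
theorem exists_dist_nest_le {i : Fin N} (hlam : ∀ j < i, ∃ L, LipschitzWith L (lam j)) :
    ∃ C : NNReal, ∀ (x y : State d) (D : ℝ), (∀ k ≥ i, dist (x k) (y k) ≤ D) →
      ∀ j, dist (nest lam i x j) (nest lam i y j) ≤ C * D := by
  have key : ∀ j, ∃ C : NNReal, ∀ (x y : State d) (D : ℝ), (∀ k ≥ i, dist (x k) (y k) ≤ D) →
      dist (nest lam i x j) (nest lam i y j) ≤ C * D := by
    intro j
    induction j using (wellFounded_gt (α := Fin N)).induction with
    | _ j ih =>
      by_cases hj : j < i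
      · obtain ⟨L, hL⟩ := hlam j hj
        choose C hC using ih
        refine ⟨L * ∑ k : {k : Fin N // j < k}, C k.1 k.2, fun x y D hD => ?_⟩
        have hD0 : 0 ≤ D := dist_nonneg.trans (hD i le_rfl)
        rw [nest_of_lt lam x hj, nest_of_lt lam y hj]
        refine (hL.dist_le_mul _ _).trans ?_
        push_cast
        rw [mul_assoc]
        refine mul_le_mul_of_nonneg_left ((dist_pi_le_iff (by positivity)).2 fun k => ?_)
          L.coe_nonneg
        refine (hC k.1 k.2 x y D hD).trans (mul_le_mul_of_nonneg_right ?_ hD0)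
        exact Finset.single_le_sum (f := fun k : {k : Fin N // j < k} => (C k.1 k.2 : ℝ))
          (fun _ _ => NNReal.coe_nonneg _) (Finset.mem_univ k)
      · exact ⟨1, fun x y D hD => by
          rw [nest_of_le lam x (not_lt.1 hj), nest_of_le lam y (not_lt.1 hj)]
          simpa using hD j (not_lt.1 hj)⟩
  choose C hC using key
  refine ⟨∑ j, C j, fun x y D hD j => (hC j x y D hD).trans ?_⟩
  have hD0 : 0 ≤ D := dist_nonneg.trans (hD i le_rfl)
  refine mul_le_mul_of_nonneg_right ?_ hD0
  exact_mod_cast Finset.single_le_sum (f := C) (fun _ _ => zero_le) (Finset.mem_univ j)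

theorem nest_congr {i : Fin N} {x y : State d} (hxy : ∀ k ≥ i, x k = y k) (j : Fin N) :
    nest lam i x j = nest lam i y j := by
  induction j using (wellFounded_gt (α := Fin N)).induction with
  | _ j ih =>
    by_cases hj : j < i
    · rw [nest_of_lt lam x hj, nest_of_lt lam y hj]
      congr 1
      ext1 k
      exact ih k.1 k.2
    · rw [nest_of_le lam x (not_lt.1 hj), nest_of_le lam y (not_lt.1 hj), hxy j (not_lt.1 hj)]

/-- The full state with slower entries `w` and vanishing remaining entries. -/
noncomputable def extendSlower (i : Fin N) (w : SlowerState d i) : State d :=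
  fun k => if hk : i < k then w ⟨k, hk⟩ else 0

theorem extendSlower_of_lt {i k : Fin N} (w : SlowerState d i) (hk : i < k) :
    extendSlower i w k = w ⟨k, hk⟩ := dif_pos hk

/-- The zero padding is harmless: entry `i` is overwritten by the update and the faster ones by the
nesting. -/
theorem limitField_extendSlower (i : Fin N) (x : State d) :
    limitField h lam i (extendSlower i fun k => x k.1) (x i) = h i (nest lam i x) := by
  rw [limitField]
  congr 1
  ext1 j
  refine nest_congr (fun k hk => ?_) j
  rcases eq_or_lt_of_le hk with rfl | hk
  · simp
  · rw [Function.update_of_ne hk.ne', extendSlower_of_lt _ hk]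

theorem exists_lipschitzWith_limitField (hh : ∀ j, ∃ L, LipschitzWith L (h j)) {i : Fin N}
    (hlam : ∀ j < i, ∃ L, LipschitzWith L (lam j)) :
    ∃ K, LipschitzWith K fun z : Block d i × SlowerState d i =>
      limitField h lam i (extendSlower i z.2) z.1 := by
  obtain ⟨L, hL⟩ := hh i
  obtain ⟨C, hC⟩ := exists_dist_nest_le hlam
  refine ⟨L * C, LipschitzWith.of_dist_le_mul fun z z' => ?_⟩
  refine (hL.dist_le_mul _ _).trans ?_
  push_cast
  rw [mul_assoc]
  refine mul_le_mul_of_nonneg_left ((dist_pi_le_iff (by positivity)).2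
    (hC _ _ (dist z z') fun k hk => ?_)) L.coe_nonneg
  rcases eq_or_lt_of_le hk with rfl | hk
  · simp only [Function.update_self]
    exact le_max_left _ _
  · rw [Function.update_of_ne hk.ne', Function.update_of_ne hk.ne', extendSlower_of_lt _ hk,
      extendSlower_of_lt _ hk]
    exact (dist_le_pi_dist z.2 z'.2 ⟨k, hk⟩).trans (le_max_right (dist z.1 z'.1) _)

/-- The quotient is a product of consecutive ratios, each tending to 0. -/
theorem tendsto_stepSize_div {α : Fin N → ℕ → ℝ} (hpos : ∀ j n, 0 < α j n)
    (hratio : ∀ i j : Fin N, i.val + 1 = j.val →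
      Tendsto (fun n => α j n / α i n) atTop (𝓝 0)) {i k : Fin N} (hik : i < k) :
    Tendsto (fun n => α k n / α i n) atTop (𝓝 0) := by
  have key : ∀ m : ℕ, ∀ k : Fin N, k.val = i.val + 1 + m →
      Tendsto (fun n => α k n / α i n) atTop (𝓝 0) := by
    intro m
    induction m with
    | zero => exact fun k hk => hratio i k hk.symm
    | succ m ih =>
      intro k hk
      have hlt : i.val + 1 + m < N := by have := k.isLt; omega
      have h1 := (hratio ⟨i.val + 1 + m, hlt⟩ k (by simp only; omega)).mul
        (ih ⟨i.val + 1 + m, hlt⟩ rfl)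
      rw [mul_zero] at h1
      refine h1.congr fun n => ?_
      have := (hpos ⟨i.val + 1 + m, hlt⟩ n).ne'
      field_simp
  exact key (k.val - i.val - 1) k (by have : i.val < k.val := hik; omega)

theorem tendsto_stepSize_zero {α : Fin N → ℕ → ℝ}
    (hsq : Summable fun n => ∑ j, α j n ^ 2) (j : Fin N) : Tendsto (α j) atTop (𝓝 0) := by
  have h1 : Tendsto (fun n => α j n ^ 2) atTop (𝓝 0) :=
    squeeze_zero (fun n => sq_nonneg _)
      (fun n => Finset.single_le_sum (f := fun j => α j n ^ 2) (fun _ _ => sq_nonneg _)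
        (Finset.mem_univ j)) hsq.tendsto_atTop_zero
  have h2 := h1.sqrt
  simp only [Real.sqrt_sq_eq_abs, Real.sqrt_zero] at h2
  exact (tendsto_zero_iff_abs_tendsto_zero _).2 h2

variable {x S : ∀ j : Fin N, ℕ → Block d j}

/-- Downward induction on `j`: nesting replaces the slower arguments of `lam j` by asymptotically
equal ones, and `lam j` is Lipschitz. -/
theorem tendsto_sub_nest {i : Fin N} (hlam : ∀ j < i, ∃ L, LipschitzWith L (lam j))
    (hfast : ∀ j < i, Tendsto (fun n => x j n - lam j fun k => x k.1 n) atTop (𝓝 0))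
    (j : Fin N) : Tendsto (fun n => x j n - nest lam i (fun k => x k n) j) atTop (𝓝 0) := by
  induction j using (wellFounded_gt (α := Fin N)).induction with
  | _ j ih =>
    by_cases hj : j < i
    · obtain ⟨L, hL⟩ := hlam j hj
      have h1 : Tendsto (fun n => fun k : {k : Fin N // j < k} =>
          x k.1 n - nest lam i (fun k => x k n) k.1) atTop (𝓝 0) :=
        tendsto_pi_nhds.2 fun k => ih k.1 k.2
      have h2 : Tendsto (fun n => lam j (fun k => x k.1 n) -
          lam j fun k => nest lam i (fun k => x k n) k.1) atTop (𝓝 0) := by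
        have h3 := h1.norm.const_mul (L : ℝ)
        rw [norm_zero, mul_zero] at h3
        exact squeeze_zero_norm (fun n => hL.norm_sub_le _ _) h3
      have h4 := (hfast j hj).add h2
      rw [add_zero] at h4
      refine h4.congr fun n => ?_
      rw [nest_of_lt lam _ hj]
      abel
    · simp [nest_of_le lam _ (not_lt.1 hj)]

/-- Convergence of one timescale, given that all faster ones have equilibrated. -/
theorem tendsto_sub_of_faster (hh : ∀ j, ∃ L, LipschitzWith L (h j)) {α : Fin N → ℕ → ℝ}
    (hpos : ∀ j n, 0 < α j n) (hsum : ∀ j, Tendsto (elapsed (α j)) atTop atTop)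
    (hsq : Summable fun n => ∑ j, α j n ^ 2)
    (hratio : ∀ i j : Fin N, i.val + 1 = j.val →
      Tendsto (fun n => α j n / α i n) atTop (𝓝 0))
    (hx : ∀ j n, x j (n + 1) = x j n + α j n • h j (fun k => x k n) + (S j (n + 1) - S j n))
    {R : ℝ} (hR : ∀ j n, ‖x j n‖ ≤ R) (hS : ∀ j, ∃ s, Tendsto (S j) atTop (𝓝 s))
    {i : Fin N} (hlam : ∀ j < i, ∃ L, LipschitzWith L (lam j))
    (hfast : ∀ j < i, Tendsto (fun n => x j n - lam j fun k => x k.1 n) atTop (𝓝 0))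
    {e : SlowerState d i → Block d i} {L : NNReal} (he : LipschitzWith L e)
    (hgas : ∀ w, IsGlobAsympStable (limitField h lam i (extendSlower i w)) (e w)) :
    Tendsto (fun n => x i n - e fun k => x k.1 n) atTop (𝓝 0) := by
  obtain ⟨K, hK⟩ := exists_lipschitzWith_limitField hh hlam
  choose s hs using hS
  have hR0 : 0 ≤ R := (norm_nonneg _).trans (hR i 0)
  have hxR : ∀ n, ‖fun k => x k n‖ ≤ R := fun n => (pi_norm_le_iff_of_nonneg hR0).2 fun k => hR k n
  -- `ε` is the cost of replacing the faster entries by their nested equilibria; `ε'` is the slower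
  -- drift rescaled to the clock of level `i`.
  refine tendsto_sub_equilibrium
    (g := fun u w => limitField h lam i (extendSlower i w) u) hK he hgas (hpos i)
    (tendsto_stepSize_zero hsq i) (hsum i) (u := x i) (w := fun n k => x k.1 n)
    (ε := fun n => h i (fun k => x k n) - h i (nest lam i fun k => x k n))
    (ε' := fun n k => (α k.1 n / α i n) • h k.1 (fun k => x k n))
    (S := S i) (S' := fun n k => S k.1 n) (fun n => ?_) (fun n => ?_) (R := R) (hR i)
    (fun n => (pi_norm_le_iff_of_nonneg hR0).2 fun k => hR k.1 n) ?_ ?_ (hs i)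
    (tendsto_pi_nhds.2 fun k => hs k.1)
  · rw [limitField_extendSlower i fun k => x k n, add_sub_cancel]
    exact hx i n
  · ext1 k
    simp only [Pi.add_apply, Pi.smul_apply, Pi.sub_apply]
    rw [hx k.1 n, smul_smul, mul_div_cancel₀ _ (hpos i n).ne']
  · obtain ⟨L', hL'⟩ := hh i
    have h1 : Tendsto (fun n => (fun k => x k n) - nest lam i fun k => x k n) atTop (𝓝 0) :=
      tendsto_pi_nhds.2 (tendsto_sub_nest hlam hfast)
    have h2 := h1.norm.const_mul (L' : ℝ)
    rw [norm_zero, mul_zero] at h2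
    exact squeeze_zero_norm (fun n => hL'.norm_sub_le _ _) h2
  · refine tendsto_pi_nhds.2 fun k => ?_
    obtain ⟨L', hL'⟩ := hh k.1
    have hbd : ∀ n, ‖h k.1 (fun j => x j n)‖ ≤ L' * R + ‖h k.1 0‖ := fun n => by
      have h1 := hL'.norm_sub_le (fun j => x j n) 0
      rw [sub_zero] at h1
      have h2 := norm_add_le (h k.1 (fun j => x j n) - h k.1 0) (h k.1 0)
      rw [sub_add_cancel] at h2
      have h3 := mul_le_mul_of_nonneg_left (hxR n) L'.coe_nonneg
      linarith
    have h1 := (tendsto_stepSize_div hpos hratio k.2).norm.mul_const (L' * R + ‖h k.1 0‖)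
    rw [norm_zero, zero_mul] at h1
    refine squeeze_zero_norm (fun n => ?_) h1
    rw [norm_smul]
    gcongr
    exact hbd n

variable [NeZero N]

/-- The pathwise convergence statement for multiple timescale stochastic approximation. -/
theorem tendsto_of_bounded_of_noise_converges (hh : ∀ j, ∃ L, LipschitzWith L (h j))
    {α : Fin N → ℕ → ℝ}
    (hpos : ∀ j n, 0 < α j n) (hsum : ∀ j, Tendsto (elapsed (α j)) atTop atTop)
    (hsq : Summable fun n => ∑ j, α j n ^ 2)
    (hratio : ∀ i j : Fin N, i.val + 1 = j.val →
      Tendsto (fun n => α j n / α i n) atTop (𝓝 0))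
    (hx : ∀ j n, x j (n + 1) = x j n + α j n • h j (fun k => x k n) + (S j (n + 1) - S j n))
    {R : ℝ} (hR : ∀ j n, ‖x j n‖ ≤ R) (hS : ∀ j, ∃ s, Tendsto (S j) atTop (𝓝 s))
    (hlamLip : ∀ i, i < ⊤ → ∃ L, LipschitzWith L (lam i))
    (hlam : ∀ i, i < ⊤ → ∀ z : State d,
      IsGlobAsympStable (limitField h lam i z) (lam i (fun k => z k.1)))
    {xstar : Block d ⊤} (hxstar : IsGlobAsympStable (limitField h lam ⊤ 0) xstar) :
    (∀ j, Tendsto (x j) atTop (𝓝 (lamTo lam j xstar))) ∧ Tendsto (x ⊤) atTop (𝓝 xstar) := by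
  have hlevel : ∀ i, i < ⊤ → Tendsto (fun n => x i n - lam i fun k => x k.1 n) atTop (𝓝 0) := by
    intro i
    induction i using (wellFounded_lt (α := Fin N)).induction with
    | _ i ih =>
      intro hi
      obtain ⟨L, hL⟩ := hlamLip i hi
      refine tendsto_sub_of_faster hh hpos hsum hsq hratio hx hR hS
        (fun j hj => hlamLip j (hj.trans hi)) (fun j hj => ih j hj (hj.trans hi)) hL fun w => ?_
      have h1 := hlam i hi (extendSlower i w)
      rwa [show (fun k : {k : Fin N // i < k} => extendSlower i w k.1) = w from
        funext fun k => extendSlower_of_lt w k.2] at h1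
  have htop : Tendsto (x ⊤) atTop (𝓝 xstar) := by
    -- No index exceeds `⊤`, so the constant map to `xstar` plays the role of the equilibrium map.
    have h1 := tendsto_sub_of_faster hh hpos hsum hsq hratio hx hR hS hlamLip hlevel
      (e := fun _ => xstar) (LipschitzWith.const xstar) fun w => by
        rwa [show extendSlower ⊤ w = 0 from funext fun k => dif_neg not_top_lt]
    simpa using h1.add_const xstar
  refine ⟨fun j => ?_, htop⟩
  obtain ⟨C, hC⟩ := exists_dist_nest_le (i := ⊤) hlamLip
  have h1 : Tendsto (fun n => nest lam ⊤ (fun k => x k n) j) atTop (𝓝 (lamTo lam j xstar)) := by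
    have h2 := (tendsto_iff_dist_tendsto_zero.1 htop).const_mul (C : ℝ)
    rw [mul_zero] at h2
    refine tendsto_iff_dist_tendsto_zero.2 (squeeze_zero (fun _ => dist_nonneg) (fun n => ?_) h2)
    refine hC _ _ _ (fun k hk => ?_) j
    obtain rfl := top_le_iff.1 hk
    simp
  simpa using (tendsto_sub_nest hlamLip hlevel j).add h1

end Levels

/-! ### Measurability with respect to the history. -/

section History

variable {N : ℕ} {d : Fin N → ℕ} {Ω : Type*} {x M : ∀ j : Fin N, ℕ → Ω → Block d j}

theorem history_mono : Monotone (history x M) := fun _ _ hmn =>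
  iSup_mono fun _ => sup_le_sup
    (iSup_mono fun _ => iSup_le fun hi => le_iSup_of_le (hi.trans hmn) le_rfl)
    (iSup_mono fun _ => iSup_le fun hi => le_iSup_of_le ⟨hi.1, hi.2.trans hmn⟩ le_rfl)

theorem measurable_iterate_history (j : Fin N) (n : ℕ) : Measurable[history x M n] (x j n) := by
  rw [measurable_iff_comap_le]
  exact le_iSup_of_le j (le_sup_of_le_left (le_iSup_of_le n (le_iSup_of_le le_rfl le_rfl)))

theorem measurable_sum_norm_history (n : ℕ) :
    Measurable[history x M n] fun ω => ∑ j, ‖x j n ω‖ := by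
  let _ := history x M n
  exact Finset.measurable_sum _ fun j _ => (measurable_iterate_history j n).norm

theorem measurable_noise_history (j : Fin N) (n : ℕ) :
    Measurable[history x M (n + 1)] (M j (n + 1)) := by
  rw [measurable_iff_comap_le]
  exact le_iSup_of_le j (le_sup_of_le_right
    (le_iSup_of_le (n + 1) (le_iSup_of_le ⟨by omega, le_rfl⟩ le_rfl)))

theorem history_le [mΩ : MeasurableSpace Ω] (hx : ∀ j n, Measurable (x j n))
    (hM : ∀ j n, Measurable (M j (n + 1))) (n : ℕ) : history x M n ≤ mΩ := by
  refine iSup_le fun j => sup_le (iSup_le fun i => iSup_le fun _ => (hx j i).comap_le)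
    (iSup_le fun i => iSup_le fun hi => ?_)
  obtain ⟨k, rfl⟩ := Nat.exists_eq_succ_of_ne_zero (by omega : i ≠ 0)
  exact (hM j k).comap_le

theorem measurable_iterates [mΩ : MeasurableSpace Ω] {h : ∀ j : Fin N, State d → Block d j}
    {α : Fin N → ℕ → ℝ} (hx0 : ∀ j, Measurable (x j 0)) (hM : ∀ j n, Measurable (M j (n + 1)))
    (hrec : ∀ j n ω, x j (n + 1) ω =
      x j n ω + α j n • (h j (fun k => x k n ω) + M j (n + 1) ω))
    (hh : ∀ j, ∃ L, LipschitzWith L (h j)) (j : Fin N) (n : ℕ) : Measurable (x j n) := by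
  induction n generalizing j with
  | zero => exact hx0 j
  | succ n ih =>
    obtain ⟨L, hL⟩ := hh j
    have h1 : Measurable fun ω => h j fun k => x k n ω :=
      hL.continuous.measurable.comp (measurable_pi_lambda _ fun k => ih k)
    rw [show x j (n + 1) = fun ω => _ from funext (hrec j n)]
    exact (ih j).add ((h1.add (hM j n)).const_smul (α j n))

end History

/-! ### From conditional moments to the pathwise statement. -/

theorem theorem2 {N : ℕ} [NeZero N] (d : Fin N → ℕ)
    {Ω : Type*} [mΩ : MeasurableSpace Ω] (P : Measure Ω) [IsProbabilityMeasure P]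
    (h : ∀ j : Fin N, State d → Block d j)
    (α : Fin N → ℕ → ℝ)
    (x M : ∀ j : Fin N, ℕ → Ω → Block d j)
    -- the `N` recursions
    (hx0 : ∀ j, Measurable (x j 0))
    (hM : ∀ j n, Measurable (M j (n + 1)))
    (hrec : ∀ j n ω, x j (n + 1) ω =
      x j n ω + α j n • (h j (fun k => x k n ω) + M j (n + 1) ω))
    -- Lipschitz continuity
    (hLip : ∀ j, ∃ L, LipschitzWith L (h j))
    -- martingale difference noise with conditional second moment bound
    (hint : ∀ j n, Integrable (M j (n + 1)) P)
    (hmart : ∀ j n, P[M j (n + 1) | history x M n] =ᵐ[P] 0)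
    (hvar : ∀ i, ∃ K : ℝ, 0 < K ∧ ∀ n, ∀ᵐ ω ∂P,
      condLExp (history x M n) P (fun ω' => ‖M i (n + 1) ω'‖ₑ ^ 2) ω ≤
        ENNReal.ofReal (K * (1 + ∑ j, ‖x j n ω‖ ^ 2)))
    -- step sizes
    (hαpos : ∀ j n, 0 < α j n)
    (hαsum : ∀ j, Tendsto (fun n => ∑ k ∈ Finset.range n, α j k) atTop atTop)
    (hαsq : Summable (fun n => ∑ j, α j n ^ 2))
    (hαratio : ∀ i j : Fin N, i.val + 1 = j.val →
      Tendsto (fun n => α j n / α i n) atTop (𝓝 0))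
    -- stability of the iterates
    (hstab : ∀ᵐ ω ∂P, BddAbove (Set.range fun n => ∑ j, ‖x j n ω‖))
    -- globally asymptotically stable equilibria of the limiting equations
    (lam : ∀ i : Fin N, SlowerState d i → Block d i)
    (hlamLip : ∀ i, i < ⊤ → ∃ L, LipschitzWith L (lam i))
    (hlam : ∀ i, i < ⊤ → ∀ z : State d,
      IsGlobAsympStable (limitField h lam i z) (lam i (fun k => z k.1)))
    (xstar : Block d ⊤)
    (hxstar : IsGlobAsympStable (limitField h lam ⊤ 0) xstar) :
    ∀ᵐ ω ∂P, (∀ j, j < ⊤ → Tendsto (fun n => x j n ω) atTop (𝓝 (lamTo lam j xstar))) ∧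
      Tendsto (fun n => x ⊤ n ω) atTop (𝓝 xstar) := by
  have hx := measurable_iterates hx0 hM hrec hLip
  let ℱ : Filtration ℕ mΩ := ⟨history x M, history_mono, history_le hx hM⟩
  have hnoise : ∀ᵐ ω ∂P, ∀ j, BddAbove (Set.range fun n => ∑ k, ‖x k n ω‖) →
      ∃ s, Tendsto (fun n => ∑ k ∈ Finset.range n, α j k • M j (k + 1) ω) atTop (𝓝 s) := by
    refine ae_all_iff.2 fun j => ?_
    have hXmeas : ∀ n, Measurable[ℱ n] fun ω => ∑ k, ‖x k n ω‖ := 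
      measurable_sum_norm_history
    refine ae_exists_tendsto_sum_smul (ℱ := ℱ) (M := fun k => M j (k + 1))
      (X := fun n ω => ∑ k, ‖x k n ω‖)
      (hαsq.of_nonneg_of_le (fun _ => sq_nonneg _) fun n =>
        Finset.single_le_sum (f := fun j => α j n ^ 2) (fun _ _ => sq_nonneg _)
          (Finset.mem_univ j))
      (measurable_noise_history j) (hint j) (hmart j) hXmeas fun c => ?_
    obtain ⟨K, hK, hKvar⟩ := hvar j
    refine ⟨K * (1 + c ^ 2), by positivity, fun k => ?_⟩
    have hA : MeasurableSet[ℱ k] {ω | ∑ i, ‖x i k ω‖ ≤ c} := hXmeas k measurableSet_Iic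
    -- On this history-measurable event the conditional second moment may be integrated instead;
    -- there the sum of squared norms is at most `c ^ 2`.
    rw [← setLIntegral_condLExp (ℱ.le k) P _ hA]
    calc ∫⁻ ω in {ω | ∑ i, ‖x i k ω‖ ≤ c},
          condLExp (ℱ k) P (fun ω' => ‖M j (k + 1) ω'‖ₑ ^ 2) ω ∂P
        ≤ ∫⁻ _ in {ω | ∑ i, ‖x i k ω‖ ≤ c}, ENNReal.ofReal (K * (1 + c ^ 2)) ∂P := by
          refine setLIntegral_mono_ae' (ℱ.le k _ hA) ?_
          filter_upwards [hKvar k] with ω hω hωA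
          refine hω.trans (ENNReal.ofReal_le_ofReal ?_)
          have h1 : ∑ i, ‖x i k ω‖ ^ 2 ≤ (∑ i, ‖x i k ω‖) ^ 2 :=
            Finset.sum_sq_le_sq_sum_of_nonneg fun _ _ => norm_nonneg _
          have h2 : (∑ i, ‖x i k ω‖) ^ 2 ≤ (c : ℝ) ^ 2 := by
            have : 0 ≤ ∑ i, ‖x i k ω‖ := Finset.sum_nonneg fun _ _ => norm_nonneg _
            gcongr
          gcongr
          exact h1.trans h2
      _ ≤ ENNReal.ofReal (K * (1 + c ^ 2)) := by
          rw [setLIntegral_const]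
          exact mul_le_of_le_one_right' prob_le_one
  filter_upwards [hstab, hnoise] with ω hω hS
  obtain ⟨R, hR⟩ := id hω
  have hconv := tendsto_of_bounded_of_noise_converges (x := fun j n => x j n ω)
    (S := fun j n => ∑ k ∈ Finset.range n, α j k • M j (k + 1) ω) hLip hαpos hαsum hαsq hαratio
    (fun j n => by
      rw [Finset.sum_range_succ, add_sub_cancel_left, hrec, smul_add, add_assoc])
    (R := R)
    (fun j n => (Finset.single_le_sum (f := fun k => ‖x k n ω‖) (fun _ _ => norm_nonneg _)
      (Finset.mem_univ j)).trans (hR ⟨n, rfl⟩))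
    (fun j => hS j hω) hlamLip hlam hxstar
  exact ⟨fun j _ => hconv.1 j, hconv.2⟩
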